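/- A Markov decision process (MDP) $\mathcal M$ consists of a countable set $S$ of states, partitioned into controlled and random states, a transition relation ${\to}\subseteq S\times S$ such that every state has at least one successor (finitely or infinitely many), for every random state $s$ a probability distribution $P(s)$ over the successors of $s$, and a reward function $r\colon S\times S\to\mathbb R$ on transitions. A strategy assigns to every partial run (finite path) $s_0s_1\cdots s_n$ ending in a controlled state a probability distribution over the successors of $s_n$; it is deterministic if all these distributions are Dirac distributions. A strategy $\sigma$ and an initial state $s_0$ induce in the usual way a probability measure $\mathcal P_{\mathcal M,s_0,\sigma}$ on the infinite runs from $s_0$. Let \[ MP_{\liminf\ge 0}=\Bigl\{s_0s_1s_2\cdots \;\Big|\; \liminf_{n\to\infty}\frac1n\sum_{j=0}^{n-1} r(s_j,s_{j+1})\ge 0\Bigr\}, \] where the $\liminf$ is taken in $[-\infty,\infty]$. **Theorem.** For every MDP $\mathcal M$, every initial state $s_0$ and every $\varepsilon>0$ there is a deterministic strategy $\sigma$ that uses only a step counter and a reward counter, i.e., whose decision after a partial run $s_0s_1\cdots s_n$ with controlled last state depends only on the number of steps $n$, the sum $\sum_{j=0}^{n-1} r(s_j,s_{j+1})$ of the rewards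 seen so far, and the current state $s_n$, and that is $\varepsilon$-optimal for $MP_{\liminf\ge 0}$ from $s_0$, i.e., \[ \mathcal P_{\mathcal M,s_0,\sigma}(MP_{\liminf\ge 0})\;\ge\;\sup_{\sigma'}\mathcal P_{\mathcal M,s_0,\sigma'}(MP_{\liminf\ge 0})-\varepsilon, \] where $\sigma'$ ranges over all (randomized, history-dependent) strategies. -/

import Mathlib

open MeasureTheory ProbabilityTheory Filter
open scoped ENNReal

/-- A Markov decision process on the state space `S` (countable wherever it is used).
The random states are the states that are not controlled. Rewards are attached to pairs of
states; only their values on transitions matter. -/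
structure MDP (S : Type*) where
  /-- the set of controlled states -/
  controlled : Set S
  /-- the transition relation -/
  trans : S → S → Prop
  exists_succ : ∀ s, ∃ s', trans s s'
  /-- the probability function on random states -/
  prob : ∀ s, s ∉ controlled → PMF S
  prob_supp : ∀ s (hs : s ∉ controlled), ∀ s' ∈ (prob s hs).support, trans s s'
  /-- the transition rewards -/
  reward : S → S → ℝ

namespace MDP

variable {S : Type*}

/-- The `i`-th state of a finite sequence `s₀ s₁ … sₙ`. -/
def stateAt {n : ℕ} (h : Finset.Iic n → S) (i : ℕ) (hi : i ≤ n) : S :=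
  h ⟨i, Finset.mem_Iic.2 hi⟩

/-- The last state of a finite sequence `s₀ s₁ … sₙ`. -/
def lastState {n : ℕ} (h : Finset.Iic n → S) : S := stateAt h n le_rfl

/-- The sequence `s₀ s₁ … sₙ` is a partial run: consecutive states are joined by transitions. -/
def IsPartialRun (M : MDP S) {n : ℕ} (h : Finset.Iic n → S) : Prop :=
  ∀ i (hi : i < n), M.trans (stateAt h i hi.le) (stateAt h (i + 1) hi)

/-- The sum of all transition rewards seen along `s₀ s₁ … sₙ`. -/
def totalReward (M : MDP S) {n : ℕ} (h : Finset.Iic n → S) : ℝ :=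
  ∑ i : Fin n, M.reward (stateAt h i i.2.le) (stateAt h (i + 1) i.2)

/-- A (general, i.e. randomized and history-dependent) strategy: it assigns to every partial run
(from any state) that ends in a controlled state a distribution over the successors of
that state. -/
structure Strategy (M : MDP S) where
  choice : ∀ (n : ℕ) (h : Finset.Iic n → S), M.IsPartialRun h → lastState h ∈ M.controlled → PMF S
  choice_supp : ∀ n h hp hc, ∀ s' ∈ (choice n h hp hc).support, M.trans (lastState h) s'

/-- A strategy is deterministic if it only takes Dirac distributions as values. -/
def Strategy.IsDeterministic {M : MDP S} (σ : M.Strategy) : Prop :=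
  ∀ n h hp hc, ∃ s', σ.choice n h hp hc = PMF.pure s'

/-- A step counter + reward counter strategy: its decision after a partial run depends only on the
number of steps taken so far, the sum of all transition rewards seen so far and the current
state. -/
def Strategy.IsStepRewardCounter {M : MDP S} (σ : M.Strategy) : Prop :=
  ∃ f : ℕ → ℝ → S → PMF S, ∀ n h hp hc,
    σ.choice n h hp hc = f n (M.totalReward h) (lastState h)

open Classical in
/-- The distribution of the next state after the sequence `s₀ s₁ … sₙ` when `σ` is played.
The value on sequences that are not partial runs is irrelevant: they have probability `0`. -/
noncomputable def nextState (M : MDP S) (σ : M.Strategy) (n : ℕ) (h : Finset.Iic n → S) : PMF S :=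
  if hc : lastState h ∈ M.controlled then
    if hp : M.IsPartialRun h then σ.choice n h hp hc else PMF.pure (lastState h)
  else M.prob (lastState h) hc

section Measure

variable [Countable S] [MeasurableSpace S] [DiscreteMeasurableSpace S]

/-- `nextState` as a Markov kernel. -/
noncomputable def stepKernel (M : MDP S) (σ : M.Strategy) (n : ℕ) :
    Kernel (Finset.Iic n → S) S where
  toFun h := (M.nextState σ n h).toMeasure
  measurable' := measurable_of_countable _

instance (M : MDP S) (σ : M.Strategy) (n : ℕ) : IsMarkovKernel (M.stepKernel σ n) :=
  ⟨fun h => PMF.toMeasure.isProbabilityMeasure (M.nextState σ n h)⟩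

/-- The probability measure on infinite sequences of states induced by the initial state `s₀` and
the strategy `σ` (it is concentrated on the runs from `s₀`): the probability of the cylinder
of `s₀ s₁ … sₙ` is the product of the one-step probabilities. -/
noncomputable def runMeasure (M : MDP S) (s₀ : S) (σ : M.Strategy) : Measure (ℕ → S) :=
  Kernel.traj (X := fun _ => S) (M.stepKernel σ) 0 (fun _ => s₀)

/-- The value of the state `s₀` for an objective `φ`. -/
noncomputable def value (M : MDP S) (φ : Set (ℕ → S)) (s₀ : S) : ℝ≥0∞ :=
  ⨆ σ : M.Strategy, M.runMeasure s₀ σ φ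

/-- `σ` is `ε`-optimal from `s₀` for `φ`: it attains at least the value minus `ε`. -/
def IsEpsOptimal (M : MDP S) (φ : Set (ℕ → S)) (s₀ : S) (ε : ℝ) (σ : M.Strategy) : Prop :=
  M.value φ s₀ ≤ M.runMeasure s₀ σ φ + ENNReal.ofReal ε

end Measure

/-- The objective that the `liminf` of the mean payoff (taken in the extended reals) is `≥ 0`. -/
def meanPayoffLiminfNonneg (M : MDP S) : Set (ℕ → S) :=
  {ρ | (0 : EReal) ≤ liminf (fun n : ℕ =>
    (((1 / (n : ℝ)) * ∑ j ∈ Finset.range n, M.reward (ρ j) (ρ (j + 1)) : ℝ) : EReal)) atTop}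

end MDP

/-!
The idea is to replace the mean payoff objective by a safety objective that the two counters can
monitor, and to play almost optimally for that.

Fix an arbitrary strategy `σ` and `η > 0`. A run satisfies the objective iff for every `k` its mean
payoff is eventually at least `-1 / (k + 1)`. By continuity from above there are times `N k` such
that, up to an event of probability at most `η / 2`, every winning run of `σ` has mean payoff at
least `-1 / (k + 1)` at all times `n ≥ N k`, simultaneously for all `k`
(`exists_thresholds`). Runs with this property are winning, and the property says that the pair
`(n, total reward)` never leaves a fixed set `G`.

For a safety objective of this kind let `u n r s` be the supremum, over all partial runs of length
`n` with total reward `r` and last state `s`, of the probability that `σ` stays in `G` from time `n`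
on after that partial run (`safeValue`). This function satisfies one half of the Bellman equation:
it vanishes outside `G`, it is at most the mean of its values after a random state, and it is at most
the supremum of its values over the successors of a controlled state. The deterministic strategy
that at time `n` picks a successor attaining this supremum up to `η / 2 ^ (n + 2)` depends on
`(n, r, s)` only, and since the losses add up to at most `η / 2`, it stays in `G` forever with
probability at least `u 0 0 s₀ - η / 2` (`safeValue_le_greedy`).
-/

namespace MDP

variable {S : Type*}

/-! ### Finite sequences of states -/

/-- The extension of a finite sequence `s₀ s₁ … sₙ` by one more state. -/
def extend {n : ℕ} (h : Finset.Iic n → S) (s : S) : Finset.Iic (n + 1) → S :=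
  fun i => if hi : i.1 ≤ n then h ⟨i, Finset.mem_Iic.2 hi⟩ else s

lemma stateAt_extend {n : ℕ} (h : Finset.Iic n → S) (s : S) (i : ℕ) (hi : i ≤ n) :
    stateAt (extend h s) i (hi.trans n.le_succ) = stateAt h i hi := by
  simp [stateAt, extend, hi]

lemma lastState_extend {n : ℕ} (h : Finset.Iic n → S) (s : S) :
    lastState (extend h s) = s := by
  simp [lastState, stateAt, extend]

lemma stateAt_extend_succ {n : ℕ} (h : Finset.Iic n → S) (s : S) :
    stateAt (extend h s) (n + 1) le_rfl = s := lastState_extend h s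

lemma IsPartialRun.extend {M : MDP S} {n : ℕ} {h : Finset.Iic n → S} (hp : M.IsPartialRun h)
    {s : S} (hs : M.trans (lastState h) s) : M.IsPartialRun (extend h s) := by
  intro i hi
  rcases (Nat.lt_succ_iff.1 hi).lt_or_eq with hin | rfl
  · rw [stateAt_extend h s i hin.le, stateAt_extend h s (i + 1) hin]
    exact hp i hin
  · rw [stateAt_extend h s i le_rfl, stateAt_extend_succ]
    exact hs

lemma totalReward_extend (M : MDP S) {n : ℕ} (h : Finset.Iic n → S) (s : S) :
    M.totalReward (extend h s) = M.totalReward h + M.reward (lastState h) s := by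
  rw [totalReward, Fin.sum_univ_castSucc, totalReward]
  congr 1
  · refine Finset.sum_congr rfl fun i _ => ?_
    simp only [Fin.val_castSucc]
    rw [stateAt_extend h s i i.2.le, stateAt_extend h s (i + 1) i.2]
  · simp only [Fin.val_last]
    rw [stateAt_extend h s n le_rfl, stateAt_extend_succ]
    rfl

lemma isPartialRun_zero (M : MDP S) (h : Finset.Iic 0 → S) : M.IsPartialRun h :=
  fun _ hi => absurd hi (Nat.not_lt_zero _)

/-- The sum of the first `n` transition rewards of an infinite sequence of states. -/
def rewardSum (M : MDP S) (n : ℕ) (ρ : ℕ → S) : ℝ :=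
  ∑ j ∈ Finset.range n, M.reward (ρ j) (ρ (j + 1))

lemma rewardSum_eq_totalReward (M : MDP S) (n : ℕ) (ρ : ℕ → S) :
    M.rewardSum n ρ = M.totalReward (Preorder.frestrictLe (π := fun _ => S) n ρ) :=
  (Fin.sum_univ_eq_sum_range (fun j => M.reward (ρ j) (ρ (j + 1))) n).symm

/-- The sequences for which `G n r` holds at every time `n ∈ T`, where `r` is the sum of the first
`n` rewards. -/
def stayIn (M : MDP S) (G : ℕ → ℝ → Prop) (T : Set ℕ) : Set (ℕ → S) :=
  {ρ | ∀ n ∈ T, G n (M.rewardSum n ρ)}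

lemma nextState_support {M : MDP S} (σ : M.Strategy) {n : ℕ} {h : Finset.Iic n → S}
    (hp : M.IsPartialRun h) {s : S} (hs : s ∈ (M.nextState σ n h).support) :
    M.trans (lastState h) s := by
  rw [nextState] at hs
  split_ifs at hs with hc
  · exact σ.choice_supp n h hp hc s hs
  · exact M.prob_supp _ hc s hs

lemma nextState_of_not_controlled {M : MDP S} (σ : M.Strategy) {n : ℕ} {h : Finset.Iic n → S}
    (hc : lastState h ∉ M.controlled) : M.nextState σ n h = M.prob (lastState h) hc := by
  rw [nextState, dif_neg hc]

instance (M : MDP S) : Nonempty M.Strategy :=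
  ⟨{ choice := fun _ h _ _ => PMF.pure (M.exists_succ (lastState h)).choose
     choice_supp := fun _ h _ _ s' hs' => by
      rw [PMF.mem_support_pure_iff] at hs'
      exact hs' ▸ (M.exists_succ (lastState h)).choose_spec }⟩

/-! ### Mean payoff and thresholds -/

lemma mem_meanPayoffLiminfNonneg_iff (M : MDP S) (ρ : ℕ → S) :
    ρ ∈ M.meanPayoffLiminfNonneg ↔
      ∀ k : ℕ, ∃ N : ℕ, ∀ n ≥ N, -(1 / ((k : ℝ) + 1)) ≤ 1 / (n : ℝ) * M.rewardSum n ρ := by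
  simp only [meanPayoffLiminfNonneg, Set.mem_ofPred_eq]
  rw [le_liminf_iff]
  constructor
  · intro H k
    have hk : ((-(1 / ((k : ℝ) + 1)) : ℝ) : EReal) < 0 := by
      rw [← EReal.coe_zero, EReal.coe_lt_coe_iff]
      have : 0 < 1 / ((k : ℝ) + 1) := by positivity
      linarith
    obtain ⟨N, hN⟩ := eventually_atTop.1 (H _ hk)
    exact ⟨N, fun n hn => (EReal.coe_lt_coe_iff.1 (hN n hn)).le⟩
  · intro H y hy
    obtain ⟨x, hyx, hx0⟩ := EReal.lt_iff_exists_real_btwn.1 hy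
    rw [← EReal.coe_zero, EReal.coe_lt_coe_iff] at hx0
    obtain ⟨k, hk⟩ := exists_nat_one_div_lt (neg_pos.2 hx0)
    obtain ⟨N, hN⟩ := H k
    refine eventually_atTop.2 ⟨N, fun n hn => hyx.trans (EReal.coe_lt_coe_iff.2 ?_)⟩
    have := hN n hn
    simp only [rewardSum] at this
    linarith

/-- The counter values for which the mean payoff `r / n` is at least `-1 / (k + 1)` for every `k`
with `N k ≤ n`. At time `0` the mean payoff is `0` by the convention for division by zero, so the
condition is void there. -/
def AboveThresholds (N : ℕ → ℕ) (n : ℕ) (r : ℝ) : Prop :=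
  ∀ k, N k ≤ n → -(1 / ((k : ℝ) + 1)) ≤ 1 / (n : ℝ) * r

lemma stayIn_aboveThresholds_subset (M : MDP S) (N : ℕ → ℕ) :
    M.stayIn (AboveThresholds N) Set.univ ⊆ M.meanPayoffLiminfNonneg := fun ρ H =>
  (M.mem_meanPayoffLiminfNonneg_iff ρ).2 fun k => ⟨N k, fun n hn => H n trivial k hn⟩

variable [Countable S] [MeasurableSpace S] [DiscreteMeasurableSpace S]

/-! ### The distribution of the run after a partial run -/

lemma measurable_rewardSum (M : MDP S) (n : ℕ) : Measurable (M.rewardSum n) := by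
  refine Finset.measurable_sum _ fun j _ => ?_
  have hpair : Measurable fun ρ : ℕ → S => (ρ j, ρ (j + 1)) := by fun_prop
  exact (measurable_of_countable fun p : S × S => M.reward p.1 p.2).comp hpair

lemma measurableSet_stayIn (M : MDP S) {G : ℕ → ℝ → Prop} (hG : ∀ n, MeasurableSet {r | G n r})
    (T : Set ℕ) : MeasurableSet (M.stayIn G T) := by
  have : M.stayIn G T = ⋂ n ∈ T, M.rewardSum n ⁻¹' {r | G n r} := by
    ext ρ; simp [stayIn]
  rw [this]
  exact MeasurableSet.biInter T.to_countable fun n _ => M.measurable_rewardSum n (hG n)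

/-- The distribution of the infinite sequence of states when `σ` is played after the sequence
`h = s₀ s₁ … sₙ`. -/
noncomputable def runMeasureFrom {M : MDP S} (σ : M.Strategy) {n : ℕ} (h : Finset.Iic n → S) :
    Measure (ℕ → S) :=
  Kernel.traj (X := fun _ => S) (M.stepKernel σ) n h

instance {M : MDP S} (σ : M.Strategy) {n : ℕ} (h : Finset.Iic n → S) :
    IsProbabilityMeasure (runMeasureFrom σ h) :=
  inferInstanceAs (IsProbabilityMeasure (Kernel.traj (X := fun _ => S) (M.stepKernel σ) n h))

instance {M : MDP S} (s₀ : S) (σ : M.Strategy) : IsProbabilityMeasure (M.runMeasure s₀ σ) :=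
  inferInstanceAs (IsProbabilityMeasure (runMeasureFrom σ (n := 0) fun _ => s₀))

lemma ae_frestrictLe_eq {M : MDP S} (σ : M.Strategy) {n : ℕ} (h : Finset.Iic n → S) :
    ∀ᵐ ρ ∂runMeasureFrom σ h, Preorder.frestrictLe (π := fun _ => S) n ρ = h := by
  have hmap : (runMeasureFrom σ h).map (Preorder.frestrictLe (π := fun _ => S) n) =
      Measure.dirac h := by
    rw [runMeasureFrom, Kernel.traj_map_frestrictLe_apply, Kernel.partialTraj_self,
      Kernel.id_apply]
  have hae : ∀ᵐ x ∂(runMeasureFrom σ h).map (Preorder.frestrictLe (π := fun _ => S) n), x = h := by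
    rw [hmap, ae_dirac_eq]
    exact Filter.eventually_pure.2 rfl
  exact ae_of_ae_map (Preorder.measurable_frestrictLe n).aemeasurable hae

/-- Conditioning on the next state. -/
lemma runMeasureFrom_apply {M : MDP S} (σ : M.Strategy) {n : ℕ} (h : Finset.Iic n → S)
    {A : Set (ℕ → S)} (hA : MeasurableSet A) :
    runMeasureFrom σ h A = ∑' s, M.nextState σ n h s * runMeasureFrom σ (extend h s) A := by
  have hmeas : Measurable fun x : Finset.Iic (n + 1) → S => runMeasureFrom σ x A :=
    measurable_of_countable _
  have hmeas' : Measurable fun x => runMeasureFrom σ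
      (IicProdIoc (X := fun _ => S) n (n + 1) x) A :=
    hmeas.comp (measurable_IicProdIoc (X := fun _ => S))
  have hglue (s : S) : IicProdIoc (X := fun _ => S) n (n + 1)
      (h, MeasurableEquiv.piSingleton (X := fun _ => S) n s) = extend h s := by
    funext i
    by_cases hi : i.1 ≤ n
    · simp [IicProdIoc, extend, hi]
    · simp [IicProdIoc, extend, hi, MeasurableEquiv.piSingleton]
  calc runMeasureFrom σ h A
      = ∫⁻ x, runMeasureFrom σ x A
          ∂(Kernel.partialTraj (X := fun _ => S) (M.stepKernel σ) n (n + 1) h) := by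
        rw [runMeasureFrom, ← Kernel.traj_comp_partialTraj (Nat.le_succ n),
          Kernel.comp_apply' _ _ _ hA]
        rfl
    _ = ∫⁻ s, runMeasureFrom σ (extend h s) A ∂(M.nextState σ n h).toMeasure := by
        rw [Kernel.partialTraj_succ_self]
        refine (Kernel.lintegral_map _ measurable_IicProdIoc h hmeas).trans ?_
        refine (Kernel.lintegral_id_prod hmeas' _ h).trans ?_
        refine (Kernel.lintegral_map _ (MeasurableEquiv.measurable _) h
          (measurable_of_countable _)).trans ?_
        simp only [hglue]
        rfl
    _ = ∑' s, M.nextState σ n h s * runMeasureFrom σ (extend h s) A := by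
        rw [lintegral_countable']
        refine tsum_congr fun s => ?_
        rw [PMF.toMeasure_apply_singleton _ _ (measurableSet_singleton s), mul_comm]

lemma runMeasureFrom_stayIn_insert_of_mem {M : MDP S} (σ : M.Strategy) {n : ℕ}
    {h : Finset.Iic n → S} {G : ℕ → ℝ → Prop} (hG : G n (M.totalReward h)) (T : Set ℕ) :
    runMeasureFrom σ h (M.stayIn G (insert n T)) = runMeasureFrom σ h (M.stayIn G T) := by
  refine measure_congr ?_
  filter_upwards [ae_frestrictLe_eq σ h] with ρ hρ
  have : G n (M.rewardSum n ρ) := by rwa [rewardSum_eq_totalReward, hρ]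
  refine propext ⟨fun H m hm => H m (Set.mem_insert_of_mem n hm), ?_⟩
  rintro H m (rfl | hm)
  · exact this
  · exact H m hm

lemma runMeasureFrom_stayIn_of_not {M : MDP S} (σ : M.Strategy) {n : ℕ}
    {h : Finset.Iic n → S} {G : ℕ → ℝ → Prop} (hG : ¬ G n (M.totalReward h)) {T : Set ℕ}
    (hn : n ∈ T) : runMeasureFrom σ h (M.stayIn G T) = 0 := by
  refine measure_eq_zero_iff_ae_notMem.2 ?_
  filter_upwards [ae_frestrictLe_eq σ h] with ρ hρ H
  refine hG ?_
  have := H n hn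
  rwa [rewardSum_eq_totalReward, hρ] at this

/-! ### Safety objectives on the step counter and the reward counter -/

/-- The supremum, over all partial runs of length `n` with total reward `r` and last state `s`, of
the probability that `σ` stays in `G` from time `n` on after that partial run. -/
noncomputable def safeValue {M : MDP S} (σ : M.Strategy) (G : ℕ → ℝ → Prop) (n : ℕ) (r : ℝ)
    (s : S) : ℝ≥0∞ :=
  ⨆ (h : Finset.Iic n → S) (_ : M.IsPartialRun h ∧ M.totalReward h = r ∧ lastState h = s),
    runMeasureFrom σ h (M.stayIn G (Set.Ici n))

lemma le_safeValue {M : MDP S} (σ : M.Strategy) (G : ℕ → ℝ → Prop) {n : ℕ}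
    {h : Finset.Iic n → S} (hp : M.IsPartialRun h) :
    runMeasureFrom σ h (M.stayIn G (Set.Ici n)) ≤
      safeValue σ G n (M.totalReward h) (lastState h) :=
  le_iSup₂_of_le h ⟨hp, rfl, rfl⟩ le_rfl

lemma safeValue_le_one {M : MDP S} (σ : M.Strategy) (G : ℕ → ℝ → Prop) (n : ℕ) (r : ℝ) (s : S) :
    safeValue σ G n r s ≤ 1 :=
  iSup₂_le fun _ _ => prob_le_one

lemma safeValue_of_not {M : MDP S} (σ : M.Strategy) {G : ℕ → ℝ → Prop} {n : ℕ} {r : ℝ}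
    (hG : ¬ G n r) (s : S) : safeValue σ G n r s = 0 := by
  refine le_antisymm (iSup₂_le ?_) zero_le
  rintro h ⟨-, rfl, -⟩
  exact (runMeasureFrom_stayIn_of_not σ hG Set.self_mem_Ici).le

/-- The safety probability after a partial run is bounded by the mean of `safeValue` at the next
state. -/
lemma runMeasureFrom_stayIn_le_tsum {M : MDP S} (σ : M.Strategy) {G : ℕ → ℝ → Prop}
    (hG : ∀ n, MeasurableSet {r | G n r}) {n : ℕ} {h : Finset.Iic n → S}
    (hp : M.IsPartialRun h) :
    runMeasureFrom σ h (M.stayIn G (Set.Ici n)) ≤ ∑' s, M.nextState σ n h s *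
      safeValue σ G (n + 1) (M.totalReward h + M.reward (lastState h) s) s := by
  have hsub : M.stayIn G (Set.Ici n) ⊆ M.stayIn G (Set.Ici (n + 1)) :=
    fun ρ H m hm => H m ((Nat.le_succ n).trans hm)
  refine (measure_mono hsub).trans ?_
  rw [runMeasureFrom_apply σ h (M.measurableSet_stayIn hG _)]
  refine ENNReal.tsum_le_tsum fun s => ?_
  by_cases hs : M.nextState σ n h s = 0
  · simp [hs]
  · have hrun := hp.extend (nextState_support σ hp ((PMF.mem_support_iff _ _).2 hs))
    have := le_safeValue σ G hrun
    rw [totalReward_extend, lastState_extend] at this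
    gcongr

lemma safeValue_le_of_not_controlled {M : MDP S} (σ : M.Strategy) {G : ℕ → ℝ → Prop}
    (hG : ∀ n, MeasurableSet {r | G n r}) (n : ℕ) (r : ℝ) {s : S} (hs : s ∉ M.controlled) :
    safeValue σ G n r s ≤
      ∑' s', M.prob s hs s' * safeValue σ G (n + 1) (r + M.reward s s') s' := by
  refine iSup₂_le ?_
  rintro h ⟨hp, rfl, rfl⟩
  rw [← nextState_of_not_controlled σ hs]
  exact runMeasureFrom_stayIn_le_tsum σ hG hp

lemma safeValue_le_iSup {M : MDP S} (σ : M.Strategy) {G : ℕ → ℝ → Prop}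
    (hG : ∀ n, MeasurableSet {r | G n r}) (n : ℕ) (r : ℝ) (s : S) :
    safeValue σ G n r s ≤
      ⨆ s' : {s' // M.trans s s'}, safeValue σ G (n + 1) (r + M.reward s s') s' := by
  refine iSup₂_le ?_
  rintro h ⟨hp, rfl, rfl⟩
  refine (runMeasureFrom_stayIn_le_tsum σ hG hp).trans ?_
  calc _ ≤ ∑' s, M.nextState σ n h s * ⨆ s' : {s' // M.trans (lastState h) s'},
        safeValue σ G (n + 1) (M.totalReward h + M.reward (lastState h) s') s' := by
        refine ENNReal.tsum_le_tsum fun s => ?_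
        by_cases hs : M.nextState σ n h s = 0
        · simp [hs]
        · have ht := nextState_support σ hp ((PMF.mem_support_iff _ _).2 hs)
          gcongr
          exact le_iSup (fun s' : {s' // M.trans (lastState h) s'} =>
            safeValue σ G (n + 1) (M.totalReward h + M.reward (lastState h) s') s') ⟨s, ht⟩
    _ = _ := by rw [ENNReal.tsum_mul_right, PMF.tsum_coe, one_mul]

/-- There may be infinitely many successors, so the supremum of `safeValue_le_iSup` need not be
attained; it is approximated up to `δ`. -/
lemma exists_succ_safeValue_le {M : MDP S} (σ : M.Strategy) {G : ℕ → ℝ → Prop}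
    (hG : ∀ n, MeasurableSet {r | G n r}) {δ : ℝ≥0∞} (hδ : δ ≠ 0) (n : ℕ) (r : ℝ) (s : S) :
    ∃ s', M.trans s s' ∧
      safeValue σ G n r s ≤ safeValue σ G (n + 1) (r + M.reward s s') s' + δ := by
  by_contra! H
  have : Nonempty {s' // M.trans s s'} := nonempty_subtype.2 (M.exists_succ s)
  have hle : safeValue σ G n r s + δ ≤ safeValue σ G n r s + 0 := by
    rw [add_zero]
    refine (add_le_add_left (safeValue_le_iSup σ hG n r s) δ).trans ?_
    rw [ENNReal.iSup_add]
    exact iSup_le fun s' => (H s' s'.2).le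
  have hfin : safeValue σ G n r s ≠ ∞ :=
    ((safeValue_le_one σ G n r s).trans_lt ENNReal.one_lt_top).ne
  exact hδ (nonpos_iff_eq_zero.1 ((ENNReal.add_le_add_iff_left hfin).1 hle))

/-- The deterministic strategy that plays according to a selection `g` of successors, given the
step counter, the reward counter and the current state. -/
noncomputable def counterStrategy (M : MDP S) (g : ℕ → ℝ → S → S)
    (hg : ∀ n r s, M.trans s (g n r s)) : M.Strategy where
  choice n h _ _ := PMF.pure (g n (M.totalReward h) (lastState h))
  choice_supp n h _ _ s' hs' := by
    rw [PMF.mem_support_pure_iff] at hs'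
    exact hs' ▸ hg n _ _

/-- The guarantee of the nearly greedy strategy, for a finite horizon `k`: if `g` loses at most
`η / 2 ^ (n + 1)` of `safeValue` at time `n`, then the losses from time `n` on add up to at most
`η / 2 ^ n`. -/
lemma safeValue_le_greedy {M : MDP S} (σ : M.Strategy) {G : ℕ → ℝ → Prop}
    (hG : ∀ n, MeasurableSet {r | G n r}) {η : ℝ≥0∞} {g : ℕ → ℝ → S → S}
    (hg : ∀ n r s, M.trans s (g n r s))
    (hgle : ∀ n r s, safeValue σ G n r s ≤
      safeValue σ G (n + 1) (r + M.reward s (g n r s)) (g n r s) + η / 2 ^ (n + 1))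
    (k : ℕ) {n : ℕ} {h : Finset.Iic n → S} (hp : M.IsPartialRun h) :
    safeValue σ G n (M.totalReward h) (lastState h) ≤
      runMeasureFrom (M.counterStrategy g hg) h (M.stayIn G (Set.Ico n (n + k))) + η / 2 ^ n := by
  induction k generalizing n with
  | zero =>
    have : M.stayIn G (Set.Ico n (n + 0)) = Set.univ := by simp [stayIn]
    rw [this, measure_univ]
    exact (safeValue_le_one _ _ _ _ _).trans le_self_add
  | succ k ih =>
    -- Outside `G` the left-hand side vanishes, so the bound is needed only for `G n r`.
    by_cases hGn : G n (M.totalReward h)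
    swap
    · rw [safeValue_of_not σ hGn]
      exact zero_le
    have hT : Set.Ico n (n + (k + 1)) = insert n (Set.Ico (n + 1) (n + 1 + k)) := by
      ext m; simp only [Set.mem_Ico, Set.mem_insert_iff]; omega
    have hη : η / 2 ^ (n + 1) + η / 2 ^ (n + 1) = η / 2 ^ n := by
      rw [← ENNReal.add_halves (η / 2 ^ n), pow_succ, div_eq_mul_inv, div_eq_mul_inv,
        div_eq_mul_inv, ENNReal.mul_inv (by simp) (by simp), mul_assoc]
    set τ := M.counterStrategy g hg
    have hnext : safeValue σ G n (M.totalReward h) (lastState h) ≤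
        (∑' s, M.nextState τ n h s *
          safeValue σ G (n + 1) (M.totalReward h + M.reward (lastState h) s) s) +
          η / 2 ^ (n + 1) := by
      by_cases hc : lastState h ∈ M.controlled
      · have hpure : M.nextState τ n h = PMF.pure (g n (M.totalReward h) (lastState h)) := by
          rw [nextState, dif_pos hc, dif_pos hp]
          rfl
        rw [hpure, tsum_eq_single (g n (M.totalReward h) (lastState h))]
        · simpa using hgle n (M.totalReward h) (lastState h)
        · intro s hs
          simp [PMF.pure_apply, hs]
      · rw [nextState_of_not_controlled τ hc]
        exact (safeValue_le_of_not_controlled σ hG n _ hc).trans le_self_add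
    rw [hT, runMeasureFrom_stayIn_insert_of_mem τ hGn,
      runMeasureFrom_apply τ h (M.measurableSet_stayIn hG _), ← hη, ← add_assoc]
    refine hnext.trans (add_le_add_left ?_ _)
    calc _ ≤ ∑' s, (M.nextState τ n h s * runMeasureFrom τ (extend h s)
            (M.stayIn G (Set.Ico (n + 1) (n + 1 + k))) +
            M.nextState τ n h s * (η / 2 ^ (n + 1))) := by
          refine ENNReal.tsum_le_tsum fun s => ?_
          by_cases hs : M.nextState τ n h s = 0
          · simp [hs]
          · have := ih (hp.extend (nextState_support τ hp ((PMF.mem_support_iff _ _).2 hs)))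
            rw [totalReward_extend, lastState_extend] at this
            rw [← mul_add]
            gcongr
      _ = _ := by rw [ENNReal.tsum_add, ENNReal.tsum_mul_right, PMF.tsum_coe, one_mul]

/-- For an objective of staying in a set of counter values, playing with the step counter and the
reward counter is as good as playing arbitrarily. -/
lemma exists_counterStrategy_stayIn {M : MDP S} (s₀ : S) (σ : M.Strategy) {G : ℕ → ℝ → Prop}
    (hG : ∀ n, MeasurableSet {r | G n r}) {η : ℝ≥0∞} (hη : η ≠ 0) :
    ∃ τ : M.Strategy, τ.IsDeterministic ∧ τ.IsStepRewardCounter ∧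
      M.runMeasure s₀ σ (M.stayIn G Set.univ) ≤ M.runMeasure s₀ τ (M.stayIn G Set.univ) + η := by
  have hδ (n : ℕ) : η / 2 ^ (n + 1) ≠ 0 := by
    simp [ENNReal.div_eq_zero_iff, hη]
  choose g hg hgle using fun n r s => exists_succ_safeValue_le σ hG (hδ n) n r s
  refine ⟨M.counterStrategy g hg, fun _ _ _ _ => ⟨_, rfl⟩,
    ⟨fun n r s => PMF.pure (g n r s), fun _ _ _ _ => rfl⟩, ?_⟩
  set h₀ : Finset.Iic 0 → S := fun _ => s₀
  -- The loss does not depend on the horizon `k`, which can therefore tend to infinity.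
  have hIci : Set.Ici 0 = (Set.univ : Set ℕ) := Set.Ici_bot
  have hfin (k : ℕ) : M.runMeasure s₀ σ (M.stayIn G Set.univ) ≤
      M.runMeasure s₀ (M.counterStrategy g hg) (M.stayIn G (Set.Ico 0 k)) + η := by
    have h1 := le_safeValue σ G (M.isPartialRun_zero h₀)
    have h2 := safeValue_le_greedy σ hG hg hgle k (M.isPartialRun_zero h₀)
    rw [hIci] at h1
    rw [pow_zero, div_one, zero_add] at h2
    exact h1.trans h2
  have hInter : M.stayIn G Set.univ = ⋂ k, M.stayIn G (Set.Ico 0 k) := by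
    ext ρ
    simp only [stayIn, Set.mem_iInter, Set.mem_ofPred_eq]
    exact ⟨fun H k n _ => H n trivial, fun H n _ => H (n + 1) n (by simp)⟩
  have hlim : Tendsto (fun k => M.runMeasure s₀ (M.counterStrategy g hg)
      (M.stayIn G (Set.Ico 0 k))) atTop
      (nhds (M.runMeasure s₀ (M.counterStrategy g hg) (M.stayIn G Set.univ))) := by
    rw [hInter]
    refine tendsto_measure_iInter_atTop
      (fun k => (M.measurableSet_stayIn hG _).nullMeasurableSet) ?_ ⟨0, measure_ne_top _ _⟩
    exact fun a b hab ρ H n hn => H n ⟨hn.1, hn.2.trans_le hab⟩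
  exact ge_of_tendsto' (hlim.add_const η) hfin

/-! ### Approximation of the mean payoff objective by a safety objective -/

lemma measurableSet_aboveThresholds (N : ℕ → ℕ) (n : ℕ) :
    MeasurableSet {r | AboveThresholds N n r} := by
  simp only [AboveThresholds, Set.ofPred_forall]
  refine MeasurableSet.iInter fun k => MeasurableSet.iInter fun _ => ?_
  exact measurableSet_le measurable_const (measurable_const.mul measurable_id)

/-- Up to an event of small probability, the winning runs satisfy a uniform convergence rate. -/
lemma exists_thresholds (M : MDP S) (μ : Measure (ℕ → S)) [IsFiniteMeasure μ] {η : ℝ≥0∞}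
    (hη : η ≠ 0) : ∃ N : ℕ → ℕ,
      μ M.meanPayoffLiminfNonneg ≤ μ (M.stayIn (AboveThresholds N) Set.univ) + η := by
  obtain ⟨δ, hδ, hsum⟩ := ENNReal.exists_pos_sum_of_countable' hη ℕ
  let good (k N : ℕ) : Set (ℕ → S) :=
    {ρ | ∀ n ≥ N, -(1 / ((k : ℝ) + 1)) ≤ 1 / (n : ℝ) * M.rewardSum n ρ}
  have hgood (k N : ℕ) : MeasurableSet (good k N) := by
    simp only [good, Set.ofPred_forall]
    refine MeasurableSet.iInter fun n => MeasurableSet.iInter fun _ => ?_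
    exact measurableSet_le measurable_const (measurable_const.mul (M.measurable_rewardSum n))
  have hmem (ρ : ℕ → S) : ρ ∈ M.meanPayoffLiminfNonneg ↔ ∀ k, ∃ N, ρ ∈ good k N :=
    M.mem_meanPayoffLiminfNonneg_iff ρ
  have hmeas : MeasurableSet M.meanPayoffLiminfNonneg := by
    have : M.meanPayoffLiminfNonneg = ⋂ k, ⋃ N, good k N := by
      ext ρ; simp only [hmem, Set.mem_iInter, Set.mem_iUnion]
    rw [this]
    exact MeasurableSet.iInter fun k => MeasurableSet.iUnion fun N => hgood k N
  have hsmall (k : ℕ) : ∃ N, μ (M.meanPayoffLiminfNonneg \ good k N) < δ k := by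
    have hlim : Tendsto (fun N => μ (M.meanPayoffLiminfNonneg \ good k N)) atTop
        (nhds (μ (⋂ N, M.meanPayoffLiminfNonneg \ good k N))) := by
      refine tendsto_measure_iInter_atTop
        (fun N => (hmeas.diff (hgood k N)).nullMeasurableSet) ?_ ⟨0, measure_ne_top _ _⟩
      exact fun a b hab ρ hρ => ⟨hρ.1, fun h => hρ.2 fun n hn => h n (hab.trans hn)⟩
    have hempty : ⋂ N, M.meanPayoffLiminfNonneg \ good k N = ∅ := by
      refine Set.eq_empty_of_forall_notMem fun ρ hρ => ?_
      obtain ⟨N, hN⟩ := (hmem ρ).1 (Set.mem_iInter.1 hρ 0).1 k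
      exact (Set.mem_iInter.1 hρ N).2 hN
    rw [hempty, measure_empty] at hlim
    exact (hlim.eventually_lt_const (hδ k)).exists
  choose N hN using hsmall
  refine ⟨N, ?_⟩
  have hcover : M.meanPayoffLiminfNonneg ⊆ M.stayIn (AboveThresholds N) Set.univ ∪
      ⋃ k, M.meanPayoffLiminfNonneg \ good k (N k) := by
    intro ρ hρ
    by_cases h : ∀ k, ρ ∈ good k (N k)
    · exact Or.inl fun n _ k hk => h k n hk
    · obtain ⟨k, hk⟩ := not_forall.1 h
      exact Or.inr (Set.mem_iUnion.2 ⟨k, hρ, hk⟩)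
  calc μ M.meanPayoffLiminfNonneg
      ≤ μ (M.stayIn (AboveThresholds N) Set.univ) +
          μ (⋃ k, M.meanPayoffLiminfNonneg \ good k (N k)) :=
        (measure_mono hcover).trans (measure_union_le _ _)
    _ ≤ _ := by
        gcongr
        exact (measure_iUnion_le _).trans
          ((ENNReal.tsum_le_tsum fun k => (hN k).le).trans hsum.le)

/-- Any strategy can be replaced by a deterministic strategy with step counter and reward counter,
at an arbitrarily small loss. -/
lemma exists_counterStrategy_meanPayoff {M : MDP S} (s₀ : S) (σ : M.Strategy) {η : ℝ≥0∞}
    (hη : η ≠ 0) :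
    ∃ τ : M.Strategy, τ.IsDeterministic ∧ τ.IsStepRewardCounter ∧
      M.runMeasure s₀ σ M.meanPayoffLiminfNonneg ≤
        M.runMeasure s₀ τ M.meanPayoffLiminfNonneg + η := by
  have hη2 : η / 2 ≠ 0 := (ENNReal.half_pos hη).ne'
  obtain ⟨N, hN⟩ := M.exists_thresholds (M.runMeasure s₀ σ) hη2
  obtain ⟨τ, hdet, hcount, hτ⟩ :=
    exists_counterStrategy_stayIn s₀ σ (measurableSet_aboveThresholds N) hη2
  refine ⟨τ, hdet, hcount, ?_⟩
  calc M.runMeasure s₀ σ M.meanPayoffLiminfNonneg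
      ≤ M.runMeasure s₀ τ (M.stayIn (AboveThresholds N) Set.univ) + η / 2 + η / 2 :=
        hN.trans (add_le_add_left hτ _)
    _ ≤ M.runMeasure s₀ τ M.meanPayoffLiminfNonneg + η := by
        rw [add_assoc, ENNReal.add_halves]
        gcongr
        exact M.stayIn_aboveThresholds_subset N

end MDP

theorem mainTheorem3 {S : Type*} [Countable S] [MeasurableSpace S] [DiscreteMeasurableSpace S]
    (M : MDP S) (s₀ : S) (ε : ℝ) (hε : 0 < ε) :
    ∃ σ : M.Strategy, σ.IsDeterministic ∧ σ.IsStepRewardCounter ∧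
      M.IsEpsOptimal M.meanPayoffLiminfNonneg s₀ ε σ := by
  set η : ℝ≥0∞ := ENNReal.ofReal ε / 2
  have hη : η ≠ 0 := (ENNReal.half_pos (ENNReal.ofReal_pos.2 hε).ne').ne'
  have hfin : M.value M.meanPayoffLiminfNonneg s₀ ≠ ∞ :=
    ((iSup_le fun _ => prob_le_one).trans_lt ENNReal.one_lt_top).ne
  obtain ⟨σ, hσ⟩ : ∃ σ : M.Strategy, M.value M.meanPayoffLiminfNonneg s₀ ≤
      M.runMeasure s₀ σ M.meanPayoffLiminfNonneg + η := by
    by_contra! H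
    have hle : M.value M.meanPayoffLiminfNonneg s₀ + η ≤
        M.value M.meanPayoffLiminfNonneg s₀ + 0 := by
      rw [add_zero]
      nth_rw 1 [MDP.value]
      rw [ENNReal.iSup_add]
      exact iSup_le fun σ => (H σ).le
    exact hη (nonpos_iff_eq_zero.1 ((ENNReal.add_le_add_iff_left hfin).1 hle))
  obtain ⟨τ, hdet, hcount, hτ⟩ := MDP.exists_counterStrategy_meanPayoff s₀ σ hη
  refine ⟨τ, hdet, hcount, hσ.trans ?_⟩
  calc _ ≤ M.runMeasure s₀ τ M.meanPayoffLiminfNonneg + η + η := add_le_add_left hτ _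
    _ = _ := by rw [add_assoc, ENNReal.add_halves]
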